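/- Let $\Gamma=(I,E,m)$ be a finite simplicial graph with edge labels $m:E\to\mathbb N_{\ge 2}$. Its Artin--Tits group is $$A_I=\Bigl\langle \sigma_i\ (i\in I)\ \Big|\ \underbrace{\sigma_i\sigma_j\sigma_i\cdots}_{m(\{i,j\})}=\underbrace{\sigma_j\sigma_i\sigma_j\cdots}_{m(\{i,j\})}\ \text{ for }\{i,j\}\in E\Bigr\rangle ,$$ and $W_I$ is the associated Coxeter group, with generators $s_i$ ($i\in I$), the same braid relations and $s_i^2=1$. For $X\subseteq I$, let $A_X$ be the Artin--Tits group of the full labelled subgraph $\Gamma_X$ spanned by $X$, let $\iota_X:A_X\to A_I$ be the morphism with $\iota_X(\sigma_x)=\sigma_x$ for $x\in X$, and let $W_X$ be the subgroup of $W_I$ generated by the $s_x$, $x\in X$. To a word $\omega=\sigma_{i_1}^{\varepsilon_1}\cdots\sigma_{i_k}^{\varepsilon_k}$ with $i_j \in I$ and $\varepsilon_j=\pm1$ associate the sequence of pairs $(r_1,\varepsilon_1),\dots,(r_k,\varepsilon_k)$, where $r_j=s_{i_1}\cdots s_{i_{j-1}}s_{i_j}s_{i_{j-1}}\cdots s_{i_1}\in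 W_I$. For $X\subseteq I$, let $\pi^*_{I,X}(\omega)$ be the word on the letters $\sigma_x^{\pm1}$, $x\in X$, whose associated sequence of pairs is obtained from that of $\omega$ by keeping exactly the pairs $(r_j,\varepsilon_j)$ with $r_j\in W_X$. Then this word exists and is unique; the map $\pi^*_{I,X}$ on words induces a map of sets $\pi_{I,X}:A_I\to A_X$; and $\iota_X$ is injective for every $X\subseteq I$. Identify each $A_X$ with its image in $A_I$. For $X\subseteq Y\subseteq I$, let $\pi_{Y,X}:A_Y\to A_X$ be the map obtained by the same construction from $\Gamma_Y$ and $X\subseteq Y$. Moreover: 1. For every $X\subseteq I$, the map $\pi_{I,X}:A_I\to A_X$ is a retraction of sets, that is, $\pi_{I,X}(\omega)=\omega$ for every $\omega\in A_X$. 2. For every $X\subseteq I$, $\omega\in A_X$ and $\omega'\in A_I$, one has $\pi_{I,X}(\omega\omega')=\omega\,\pi_{I,X}(\omega')$. 3. For all $X,Y\subseteq I$ and $\omega\in A_I$, one has $\pi_{I,Y}(\pi_{I,X}(\omega))=\pi_{I,X}(\pi_{I,Y}(\omega))=\pi_{I,X\cap Y}(\omega)$. 4. Let $X\subseteq Y\subseteq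 I$. (a) The restriction of $\pi_{I,X}$ to $A_Y$ is $\pi_{Y,X}$. (b) For every $\omega\in A_I$, one has $\pi_{Y,X}(\pi_{I,Y}(\omega))=\pi_{I,X}(\omega)$. -/

import Mathlib

namespace ArtinTits

variable {I : Type*}

/-! A finite simplicial graph with vertex set `I` and edge labels in `{2, 3, ...}` is encoded by a
Coxeter matrix `M` on `I`: for `i ≠ j`, the entry `M i j` is the label of the edge `{i, j}`, and
`M i j = 0` means that `{i, j}` is not an edge (Mathlib's convention for the label `∞`). -/

/-- The full labelled subgraph spanned by a set `X` of vertices. -/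
def restrict (M : CoxeterMatrix I) (X : Set I) : CoxeterMatrix X where
  M := Matrix.of fun x y => M x y
  isSymm := Matrix.IsSymm.ext fun x y => M.symmetric y x
  diagonal x := M.diagonal x
  off_diagonal x y h := M.off_diagonal x y fun e => h (Subtype.ext e)

/-- The alternating product `a * b * a * ⋯` with `n` factors. -/
def altProd {G : Type*} [Group G] : G → G → ℕ → G
  | _, _, 0 => 1
  | a, b, n + 1 => a * altProd b a n

/-- The defining relators of the Artin-Tits group: one for each (oriented) edge. -/
def relators (M : CoxeterMatrix I) : Set (FreeGroup I) :=
  {r | ∃ i j : I, i ≠ j ∧ M i j ≠ 0 ∧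
    r = altProd (FreeGroup.of i) (FreeGroup.of j) (M i j) *
      (altProd (FreeGroup.of j) (FreeGroup.of i) (M i j))⁻¹}

/-- The Artin-Tits group `A_I`. -/
abbrev ArtinGroup (M : CoxeterMatrix I) : Type _ := PresentedGroup (relators M)

/-- The generator `σ_i` of the Artin-Tits group. -/
def gen (M : CoxeterMatrix I) (i : I) : ArtinGroup M := PresentedGroup.of i

/-- The element of `A_I` represented by a word on the letters `σ_i` and `σ_i⁻¹`; the letter
`(i, true)` stands for `σ_i` and the letter `(i, false)` for `σ_i⁻¹`. -/
def eval (M : CoxeterMatrix I) (ω : List (I × Bool)) : ArtinGroup M :=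
  (ω.map fun a => if a.2 then gen M a.1 else (gen M a.1)⁻¹).prod

theorem eval_surjective (M : CoxeterMatrix I) : Function.Surjective (eval M) := by
  intro a
  obtain ⟨g, rfl⟩ := PresentedGroup.mk_surjective (relators M) a
  induction g using FreeGroup.induction_on with
  | C1 => exact ⟨[], by simp [eval]⟩
  | of i => exact ⟨[(i, true)], by simp [eval, gen, PresentedGroup.of]⟩
  | inv_of i _ => exact ⟨[(i, false)], by simp [eval, gen, PresentedGroup.of]⟩
  | mul x y hx hy =>
    obtain ⟨u, hu⟩ := hx
    obtain ⟨v, hv⟩ := hy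
    refine ⟨u ++ v, ?_⟩
    rw [map_mul, ← hu, ← hv]
    simp [eval]

theorem map_altProd {G H : Type*} [Group G] [Group H] (f : G →* H) (n : ℕ) :
    ∀ a b : G, f (altProd a b n) = altProd (f a) (f b) n := by
  induction n with
  | zero => intro a b; simp [altProd]
  | succ n ih => intro a b; simp [altProd, ih]

theorem altProd_gen (M : CoxeterMatrix I) (i j : I) :
    altProd (gen M i) (gen M j) (M i j) = altProd (gen M j) (gen M i) (M i j) := by
  by_cases hij : i = j
  · subst hij; rfl
  by_cases h0 : M i j = 0
  · rw [h0]; rfl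
  have h : PresentedGroup.mk (relators M) _ = 1 :=
    PresentedGroup.one_of_mem (rels := relators M) ⟨i, j, hij, h0, rfl⟩
  rw [map_mul, map_inv, mul_inv_eq_one, map_altProd, map_altProd] at h
  exact h

/-- The canonical morphism `ι_X : A_X → A_I`, sending `σ_x` to `σ_x` for every `x ∈ X`. -/
def incl (M : CoxeterMatrix I) (X : Set I) : ArtinGroup (restrict M X) →* ArtinGroup M :=
  PresentedGroup.toGroup (f := fun x : X => gen M x) (by
    rintro r ⟨i, j, -, -, rfl⟩
    rw [map_mul, map_inv, mul_inv_eq_one, map_altProd, map_altProd, FreeGroup.lift_apply_of,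
      FreeGroup.lift_apply_of]
    exact altProd_gen M i j)

/-- The standard parabolic subgroup `W_X` of the Coxeter group `W_I`. -/
def coxeterParabolic (M : CoxeterMatrix I) (X : Set I) : Subgroup M.Group :=
  Subgroup.closure (M.simple '' X)

/-- For a word `ω = σ_{i₁}^{ε₁} ⋯ σ_{iₖ}^{εₖ}`, the sequence of pairs `(r_j, ε_j)`, where
`r_j = s_{i₁} ⋯ s_{i_{j-1}} s_{i_j} s_{i_{j-1}} ⋯ s_{i₁}` in `W_I`. -/
def signedReflections (M : CoxeterMatrix I) (ω : List (I × Bool)) : List (M.Group × Bool) :=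
  (M.toCoxeterSystem.leftInvSeq (ω.map Prod.fst)).zip (ω.map Prod.snd)

open Classical in
/-- `η` is a word on the letters `σ_x`, `σ_x⁻¹` with `x ∈ X` whose sequence of pairs `(r_j, ε_j)` is
obtained from that of `ω` by keeping exactly the pairs with `r_j ∈ W_X`. -/
def IsRetractWord (M : CoxeterMatrix I) (X : Set I) (ω : List (I × Bool))
    (η : List (X × Bool)) : Prop :=
  signedReflections M (η.map fun a => ((a.1 : I), a.2)) =
    (signedReflections M ω).filter fun p => p.1 ∈ coxeterParabolic M X

open Classical in
/-- The map `π*_{I,X}` on words: `π*_{I,X}(ω)` is the word `η` with `IsRetractWord M X ω η`. -/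
noncomputable def piWord (M : CoxeterMatrix I) (X : Set I) (ω : List (I × Bool)) :
    List (X × Bool) :=
  if h : ∃ η, IsRetractWord M X ω η then h.choose else []

/-- The map of sets `π_{I,X} : A_I → A_X` induced by `π*_{I,X}`: apply `π*_{I,X}` to a word
representing the given element. -/
noncomputable def piMap (M : CoxeterMatrix I) (X : Set I) (a : ArtinGroup M) :
    ArtinGroup (restrict M X) :=
  eval (restrict M X) (piWord M X (Function.surjInv (eval_surjective M) a))

/-- A subset `X` of `I`, seen as a set of vertices of the subgraph spanned by `Y`
(used for `X ⊆ Y`). -/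
def sub (X Y : Set I) : Set Y := {y | (y : I) ∈ X}

end ArtinTits

/-! The retraction is computed by a transducer whose states are the minimal representatives `w` of
the cosets `W_X w`. Reading a letter `σ_i^ε` in state `w`, one looks at `w s_i w⁻¹`. If it lies in
`W_X`, it must be a simple reflection `s_x` with `x ∈ X`: the letter `σ_x^ε` is written and the
state is kept. Otherwise nothing is written and the state becomes `w s_i`, again minimal. Started at
`1`, the transducer writes a word whose signed reflections are exactly those of the input that lie
in `W_X` (`MinimalRep.signedReflections_scan`). Uniqueness holds because the signed reflections
determine a word.

Passing to groups rests on `MinimalRep.scan_braid`: from any state, the two sides of a braid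
relation are both turned into the empty word, or into the two sides of a braid relation of `A_X`.
The reflections along one side form a cyclic sequence of dihedral type, the other side lists them
backwards, and those lying in a conjugate of `W_X` occur at equally spaced places. The length of the
resulting relation is the right one because `s_x s_y` has order exactly `M x y`. The transducer
therefore defines a right action of `A_I` on `A_X × (W_X \ W_I)`, and `π_{I,X}(a)` is the first
component of `(1, 1) · a`.

A word on `X` read from state `1` is copied and leaves the state unchanged. This gives the
retraction property, the equivariance and the injectivity of `ι_X`. The composition rules are
statements about filtering lists of reflections: they reduce to `W_X ∩ W_Y = W_{X ∩ Y}` and to the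
injectivity of the map from the Coxeter group of `Γ_Y` to `W_I`.

The facts used about Coxeter groups come from the geometric representation (exact orders) and from
the parity of the number of times a reflection occurs as an inversion. -/

namespace ArtinTits

variable {I : Type*}

/-! ### The geometric representation and the exact order of `s_i s_j` -/

section ReflectionRepresentation

open Real Module Polynomial.Chebyshev

variable {V : Type*} [AddCommGroup V] [Module ℝ V] {x y : V} {f g : Dual ℝ V}

theorem sin_two_pi_div_pos {m : ℕ} (hm : 3 ≤ m) : 0 < sin (2 * π / m) := by
  have h3 : (3 : ℝ) ≤ m := by exact_mod_cast hm
  apply sin_pos_of_pos_of_lt_pi (by positivity)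
  rw [div_lt_iff₀ (by linarith)]
  nlinarith [pi_pos]

/-- The product of two reflections whose roots span an angle `π - π / m` has order dividing `m`. -/
theorem reflection_mul_reflection_pow_eq_one (hf : f x = 2) (hg : g y = 2) {m : ℕ} (hm : 2 ≤ m)
    (hfy : f y = -2 * cos (π / m)) (hgx : g x = -2 * cos (π / m)) :
    (reflection hf * reflection hg) ^ m = 1 := by
  obtain rfl | hm := hm.eq_or_lt
  -- For `m = 2` the angle `2π / m` has zero sine, so the Chebyshev argument below, which divides by
  -- it, does not apply.
  · have h0 : cos (π / (2 : ℕ)) = 0 := by simp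
    rw [h0, mul_zero] at hfy hgx
    ext z
    simp only [pow_two, LinearEquiv.mul_apply, reflection_apply, map_sub, map_smul, hf, hg, hfy,
      hgx, LinearEquiv.coe_one, id_eq]
    module
  have hm0 : (m : ℝ) ≠ 0 := by positivity
  have hs := (sin_two_pi_div_pos hm).ne'
  set θ := 2 * π / m with hθ
  have hmθ : m * θ = 2 * π := by rw [hθ]; field_simp
  have ht : 2 * cos θ = f y * g x - 2 := by
    rw [hfy, hgx, show θ = 2 * (π / m) by rw [hθ]; ring, cos_two_mul]
    ring
  -- `S_k (2 cos θ) sin θ = sin ((k + 1) θ)` turns the coefficients of the power formula into sines,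
  -- which vanish or cancel because `m θ = 2π`.
  have hS (k : ℤ) := S_two_mul_real_cos θ k
  apply LinearEquiv.toLinearMap_injective
  rw [reflection_mul_reflection_pow hf hg m _ ht]
  rcases Nat.even_or_odd' m with ⟨k, rfl | rfl⟩
  · have hk : (S ℝ (k - 1 : ℤ)).eval (2 * cos θ) = 0 := by
      apply (mul_eq_zero_iff_right hs).1
      rw [hS, show (((k : ℤ) - 1 : ℤ) + 1 : ℝ) * θ = π by push_cast at hmθ ⊢; linarith, sin_pi]
    rw [show (((2 * k : ℕ) : ℤ) - 2) / 2 = k - 1 by omega,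
      show (((2 * k : ℕ) : ℤ) - 1) / 2 = k - 1 by omega, hk]
    simp
  · have hk : (S ℝ (k : ℤ)).eval (2 * cos θ) + (S ℝ (k - 1 : ℤ)).eval (2 * cos θ) = 0 := by
      apply (mul_eq_zero_iff_right hs).1
      rw [add_mul, hS, hS, show (((k : ℤ) : ℝ) + 1) * θ = 2 * π - k * θ by
        push_cast at hmθ ⊢; linarith, sin_two_pi_sub]
      push_cast
      ring_nf
    rw [show (((2 * k + 1 : ℕ) : ℤ) - 2) / 2 = k - 1 by omega,
      show (((2 * k + 1 : ℕ) : ℤ) - 1) / 2 = k by omega,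
      show (((2 * k + 1 : ℕ) : ℤ) - 3) / 2 = k - 1 by omega,
      show (((2 * k + 1 : ℕ) : ℤ)) / 2 = k by omega, hk]
    simp

/-- Comparing coordinates of the image of `x` gives `S_n + S_{n-1} = 1` and `S_{n-1} * g x = 0`. For
`m ≥ 3` this forces `cos (n θ) = 1` with `θ = 2π / m`. -/
theorem dvd_of_reflection_mul_reflection_pow_eq_one (hf : f x = 2) (hg : g y = 2) {m : ℕ}
    (hm : m ≠ 1) (hxy : LinearIndependent ℝ ![x, y])
    (hfy : f y = -2 * cos (π / m)) (hgx : g x = -2 * cos (π / m)) {n : ℕ}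
    (hn : (reflection hf * reflection hg) ^ n = 1) : m ∣ n := by
  have h := reflection_mul_reflection_pow_apply_self hf hg n
  rw [hn] at h
  have h' := LinearIndependent.pair_iff.1 hxy
    ((S ℝ n).eval (f y * g x - 2) + (S ℝ (n - 1)).eval (f y * g x - 2) - 1)
    ((S ℝ (n - 1)).eval (f y * g x - 2) * -g x) (by
      rw [sub_smul, one_smul, sub_add_eq_add_sub, ← h]; simp)
  obtain ⟨h1, h2⟩ := h'
  obtain h0 | h0 | h0 : m = 0 ∨ m = 2 ∨ 3 ≤ m := by omega
  -- Label `∞`: since `π / 0 = 0`, both off-diagonal values are `-2`, and `S_{n-1}(2) = n` forces `n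
  -- = 0`.
  · subst h0
    simp only [CharP.cast_eq_zero, div_zero, cos_zero] at hfy hgx
    rw [hfy, hgx, show (-2 * 1 : ℝ) * (-2 * 1) - 2 = 2 by norm_num, S_eval_two] at h2
    have : (n : ℝ) = 0 := by push_cast at h2; linarith
    simpa using this
  · subst h0
    have hc : cos (π / (2 : ℕ)) = 0 := by simp
    rw [hc, mul_zero] at hfy hgx
    have hsq : (reflection hf * reflection hg) ^ 2 = 1 :=
      reflection_mul_reflection_pow_eq_one hf hg le_rfl (by rw [hfy, hc]; simp)
        (by rw [hgx, hc]; simp)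
    -- An odd power of the product equals the product itself, which sends `x` to `-x`.
    by_contra hodd
    obtain ⟨k, rfl⟩ : Odd n := Nat.not_even_iff_odd.1 fun h => hodd h.two_dvd
    rw [pow_succ, pow_mul, hsq, one_pow, one_mul] at hn
    have hx := congrArg (fun φ => φ x) hn
    simp only [LinearEquiv.mul_apply, reflection_apply, hgx, zero_smul, sub_zero, hf,
      LinearEquiv.coe_one, id_eq] at hx
    have hx0 : x = 0 := by
      have : (2 : ℝ) • x = 0 := by
        rw [sub_eq_self] at hx; exact hx
      simpa using this
    exact hxy.ne_zero 0 hx0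
  · have hm0 : (m : ℝ) ≠ 0 := by positivity
    have hs := (sin_two_pi_div_pos h0).ne'
    have hc : 0 < cos (π / m) := by
      have h3 : (3 : ℝ) ≤ m := by exact_mod_cast h0
      apply cos_pos_of_mem_Ioo
      constructor
      · have : 0 < π / m := by positivity
        linarith [pi_pos]
      · apply div_lt_div_of_pos_left pi_pos <;> linarith
    set θ := 2 * π / m with hθ
    have ht : f y * g x - 2 = 2 * cos θ := by
      rw [hfy, hgx, show θ = 2 * (π / m) by rw [hθ]; ring, cos_two_mul]
      ring
    rw [ht] at h1 h2
    have h2' : (S ℝ (n - 1)).eval (2 * cos θ) = 0 := by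
      rcases mul_eq_zero.1 h2 with h | h
      · exact h
      · rw [hgx] at h; linarith
    have hsn := S_two_mul_real_cos θ (n - 1)
    have hsn' := S_two_mul_real_cos θ n
    rw [h2', add_zero] at h1
    rw [h2', zero_mul] at hsn
    rw [sub_eq_zero.1 h1, one_mul] at hsn'
    push_cast at hsn hsn'
    rw [sub_add_cancel] at hsn
    rw [add_mul, one_mul, sin_add, ← hsn, zero_mul, zero_add] at hsn'
    have hcos : cos (n * θ) = 1 := (mul_eq_right₀ hs).1 hsn'.symm
    obtain ⟨k, hk⟩ := (cos_eq_one_iff _).1 hcos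
    have : (k * m : ℝ) = n := by
      rw [hθ] at hk
      field_simp at hk
      linarith
    have : k * m = (n : ℤ) := by exact_mod_cast this
    exact Int.natCast_dvd_natCast.1 ⟨k, by rw [← this, mul_comm]⟩

/-- The simple coroot of index `i` in the geometric representation. -/
noncomputable def simpleCoroot (M : CoxeterMatrix I) (i : I) : Dual ℝ (I →₀ ℝ) :=
  Finsupp.linearCombination ℝ fun j => -2 * cos (π / M i j)

theorem simpleCoroot_single (M : CoxeterMatrix I) (i j : I) :
    simpleCoroot M i (Finsupp.single j 1) = -2 * cos (π / M i j) := by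
  simp [simpleCoroot]

theorem simpleCoroot_single_self (M : CoxeterMatrix I) (i : I) :
    simpleCoroot M i (Finsupp.single i 1) = 2 := by
  simp [simpleCoroot_single]

/-- The geometric representation of a Coxeter group. -/
noncomputable def geometricRep (M : CoxeterMatrix I) : M.Group →* ((I →₀ ℝ) ≃ₗ[ℝ] (I →₀ ℝ)) :=
  M.toCoxeterSystem.lift ⟨fun i => reflection (simpleCoroot_single_self M i), fun i j => by
    by_cases hij : i = j
    · subst hij
      ext1 z
      simp only [M.diagonal, pow_one, LinearEquiv.mul_apply]
      exact involutive_reflection (simpleCoroot_single_self M i) z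
    by_cases h0 : M i j = 0
    · rw [h0, pow_zero]
    have h1 := M.off_diagonal i j hij
    refine reflection_mul_reflection_pow_eq_one _ _ (by omega) (simpleCoroot_single M i j) ?_
    rw [simpleCoroot_single, M.symmetric]⟩

theorem geometricRep_simple (M : CoxeterMatrix I) (i : I) :
    geometricRep M (M.simple i) = reflection (simpleCoroot_single_self M i) :=
  M.toCoxeterSystem.lift_apply_simple _ i

theorem orderOf_simple_mul_simple (M : CoxeterMatrix I) (i j : I) :
    orderOf (M.simple i * M.simple j) = M i j := by
  by_cases hij : i = j
  · subst hij
    rw [← CoxeterMatrix.toCoxeterSystem_simple, CoxeterSystem.simple_mul_simple_self, orderOf_one,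
      M.diagonal]
  apply Nat.dvd_antisymm
  · exact orderOf_dvd_of_pow_eq_one (M.toCoxeterSystem.simple_mul_simple_pow i j)
  · have hn := congrArg (geometricRep M)
      (pow_orderOf_eq_one (M.simple i * M.simple j))
    rw [map_pow, map_mul, geometricRep_simple, geometricRep_simple, map_one] at hn
    refine dvd_of_reflection_mul_reflection_pow_eq_one _ _ (M.off_diagonal i j hij) ?_
      (simpleCoroot_single M i j) (by rw [simpleCoroot_single, M.symmetric]) hn
    rw [LinearIndependent.pair_iff]
    intro a b hab
    have h1 := DFunLike.congr_fun hab i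
    have h2 := DFunLike.congr_fun hab j
    simp [hij, Ne.symm hij] at h1 h2
    exact ⟨h1, h2⟩

theorem simple_injective (M : CoxeterMatrix I) :
    Function.Injective M.simple := by
  intro i j h
  by_contra hij
  have := orderOf_simple_mul_simple M i j
  rw [h, ← CoxeterMatrix.toCoxeterSystem_simple, CoxeterSystem.simple_mul_simple_self,
    orderOf_one] at this
  exact M.off_diagonal i j hij this.symm

end ReflectionRepresentation

/-! ### Parity of inversions -/

section Parity

theorem simple_mul_self (M : CoxeterMatrix I) (i : I) : M.simple i * M.simple i = 1 :=
  M.toCoxeterSystem.simple_mul_simple_self i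

theorem simple_mul_cancel_left (M : CoxeterMatrix I) (i : I) (w : M.Group) :
    M.simple i * (M.simple i * w) = w :=
  M.toCoxeterSystem.simple_mul_simple_cancel_left i

theorem simple_inv (M : CoxeterMatrix I) (i : I) : (M.simple i)⁻¹ = M.simple i :=
  M.toCoxeterSystem.inv_simple i

theorem simple_mul_pow_comm (M : CoxeterMatrix I) (i j : I) (n : ℕ) :
    M.simple j * (M.simple i * M.simple j) ^ n = (M.simple j * M.simple i) ^ n * M.simple j :=
  ((show SemiconjBy (M.simple j) (M.simple i * M.simple j) (M.simple j * M.simple i) from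
    (mul_assoc _ _ _).symm).pow_right n).eq

theorem simple_mul_simple_inv (M : CoxeterMatrix I) (i j : I) :
    (M.simple i * M.simple j)⁻¹ = M.simple j * M.simple i := by
  rw [mul_inv_rev, simple_inv, simple_inv]

open Classical in
/-- The action of a simple reflection on pairs (element, parity). -/
noncomputable def parityStep (M : CoxeterMatrix I) (i : I) : Function.End (M.Group × ZMod 2) :=
  fun p => (M.simple i * p.1 * M.simple i, p.2 + if p.1 = M.simple i then 1 else 0)

-- The sum counts `t` among the reflections of the dihedral group generated by `s_i` and `s_j`,
-- taken twice around when `n = M i j`. This is what makes the parity action respect the Coxeter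
-- relations.
open Classical in
theorem parityStep_mul_pow (M : CoxeterMatrix I) (i j : I) (n : ℕ) :
    ∀ (t : M.Group) (ε : ZMod 2), ((parityStep M i * parityStep M j) ^ n) (t, ε) =
      ((M.simple i * M.simple j) ^ n * t * (M.simple j * M.simple i) ^ n,
        ε + ∑ k ∈ Finset.range (2 * n),
          if t = (M.simple j * M.simple i) ^ k * M.simple j then 1 else 0) := by
  induction n with
  | zero => intro t ε; simp; rfl
  | succ n ih =>
    intro t ε
    have key (a : M.Group) (l : I) : M.simple l * t * M.simple l = a ↔
        t = M.simple l * a * M.simple l := by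
      constructor <;> rintro rfl <;>
        simp only [mul_assoc, simple_mul_self, simple_mul_cancel_left, mul_one]
    rw [pow_succ]
    change ((parityStep M i * parityStep M j) ^ n) (parityStep M i (parityStep M j (t, ε))) = _
    simp only [parityStep]
    rw [ih]
    refine Prod.ext ?_ ?_
    · dsimp only
      rw [pow_succ, pow_succ']
      simp only [mul_assoc]
    · dsimp only
      rw [show 2 * (n + 1) = 2 * n + 1 + 1 by ring, Finset.sum_range_succ', Finset.sum_range_succ']
      have h1 : (M.simple j * t * M.simple j = M.simple i) ↔
          t = (M.simple j * M.simple i) ^ (0 + 1) * M.simple j := by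
        rw [key, zero_add, pow_one]
      have h2 (k : ℕ) : M.simple i * (M.simple j * t * M.simple j) * M.simple i =
          (M.simple j * M.simple i) ^ k * M.simple j ↔
          t = (M.simple j * M.simple i) ^ (k + 1 + 1) * M.simple j := by
        have : M.simple i * (M.simple j * t * M.simple j) * M.simple i =
            (M.simple i * M.simple j) * t * (M.simple i * M.simple j)⁻¹ := by
          rw [simple_mul_simple_inv]; simp only [mul_assoc]
        rw [this, mul_inv_eq_iff_eq_mul, ← eq_inv_mul_iff_mul_eq, simple_mul_simple_inv,
          mul_assoc _ (M.simple j), ← mul_assoc (M.simple j) (M.simple i), pow_succ, pow_succ']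
        simp only [mul_assoc]
      simp only [h1, h2, pow_zero, one_mul]
      ring

/-- The parity action of a Coxeter group on pairs (element, parity). -/
noncomputable def parityHom (M : CoxeterMatrix I) :
    M.Group →* Function.End (M.Group × ZMod 2) :=
  M.toCoxeterSystem.lift ⟨parityStep M, fun i j => by
    classical
    funext ⟨t, ε⟩
    have h1 : (M.simple i * M.simple j) ^ M i j = 1 :=
      M.toCoxeterSystem.simple_mul_simple_pow i j
    have h2 : (M.simple j * M.simple i) ^ M i j = 1 :=
      M.toCoxeterSystem.simple_mul_simple_pow' i j
    -- The summand has period `M i j`, so the two halves of the sum agree and cancel modulo 2.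
    rw [parityStep_mul_pow, h1, h2, two_mul, Finset.sum_range_add]
    simp only [pow_add, h2, one_mul, mul_one, CharTwo.add_self_eq_zero, add_zero]
    rfl⟩

theorem parityHom_simple (M : CoxeterMatrix I) (i : I) :
    parityHom M (M.simple i) = parityStep M i :=
  M.toCoxeterSystem.lift_apply_simple _ i

/-- The parity of the number of occurrences of `t` in the left inversion sequence of any word
for `w`. -/
noncomputable def parity (M : CoxeterMatrix I) (w t : M.Group) : ZMod 2 :=
  (parityHom M w⁻¹ (t, 0)).2

theorem parityHom_apply (M : CoxeterMatrix I) (w : M.Group) :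
    ∀ (t : M.Group) (ε : ZMod 2),
      parityHom M w (t, ε) = (w * t * w⁻¹, ε + (parityHom M w (t, 0)).2) := by
  induction w using M.toCoxeterSystem.simple_induction_left with
  | one =>
    intro t ε
    rw [map_one]
    refine Prod.ext ?_ ?_
    · change t = 1 * t * 1⁻¹
      group
    · exact (add_zero ε).symm
  | mul_simple_left w i ih =>
    intro t ε
    change parityHom M (M.simple i * w) (t, ε) =
      (M.simple i * w * t * (M.simple i * w)⁻¹, ε + (parityHom M (M.simple i * w) (t, 0)).2)
    rw [map_mul]
    change parityHom M (M.simple i) (parityHom M w (t, ε)) =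
      (_, ε + (parityHom M (M.simple i) (parityHom M w (t, 0))).2)
    rw [ih t ε, ih t 0, parityHom_simple]
    simp only [parityStep, mul_inv_rev, simple_inv]
    refine Prod.ext ?_ ?_
    · simp only [mul_assoc]
    · dsimp only; ring

theorem parity_one (M : CoxeterMatrix I) (t : M.Group) : parity M 1 t = 0 := by
  rw [parity, inv_one, map_one]; rfl

open Classical in
theorem parity_simple (M : CoxeterMatrix I) (i : I) (t : M.Group) :
    parity M (M.simple i) t = if t = M.simple i then 1 else 0 := by
  rw [parity, simple_inv, parityHom_simple]; simp [parityStep]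

/-- The cocycle rule: inversions of a product are those of `u` together with those of `v` conjugated
by `u`, modulo 2. -/
theorem parity_mul (M : CoxeterMatrix I) (u v t : M.Group) :
    parity M (u * v) t = parity M u t + parity M v (u⁻¹ * t * u) := by
  rw [parity, mul_inv_rev, map_mul]
  change (parityHom M v⁻¹ (parityHom M u⁻¹ (t, 0))).2 = _
  rw [parityHom_apply M u⁻¹, parityHom_apply M v⁻¹]
  simp [parity]

open Classical in
theorem parity_wordProd (M : CoxeterMatrix I) (ω : List I) : ∀ t : M.Group,
    parity M (M.toCoxeterSystem.wordProd ω) t =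
      ((M.toCoxeterSystem.leftInvSeq ω).count t : ZMod 2) := by
  induction ω with
  | nil => intro t; simp [parity_one]
  | cons i ω ih =>
    intro t
    rw [CoxeterSystem.wordProd_cons, CoxeterMatrix.toCoxeterSystem_simple, parity_mul, ih,
      parity_simple, CoxeterSystem.leftInvSeq, List.count_cons]
    have h : t = MulAut.conj (M.simple i) ((M.simple i)⁻¹ * t * M.simple i) := by
      rw [MulAut.conj_apply]; group
    conv_rhs => rw [h]
    rw [CoxeterMatrix.toCoxeterSystem_simple, List.count_map_of_injective _ _
      (MulAut.conj (M.simple i)).injective, ← h]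
    by_cases hi : t = M.simple i
    · simp [hi, add_comm]
    · simp [hi, Ne.symm hi]

end Parity

/-! ### Standard parabolic subgroups of the Coxeter group -/

section Parabolic

theorem simple_mem_coxeterParabolic (M : CoxeterMatrix I) {X : Set I} {x : I} (hx : x ∈ X) :
    M.simple x ∈ coxeterParabolic M X :=
  Subgroup.subset_closure ⟨x, hx, rfl⟩

theorem leftInvSeq_subset_coxeterParabolic (M : CoxeterMatrix I) {X : Set I} {ω : List I}
    (hω : ∀ i ∈ ω, i ∈ X) : ∀ t ∈ M.toCoxeterSystem.leftInvSeq ω, t ∈ coxeterParabolic M X := by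
  induction ω with
  | nil => simp
  | cons i ω ih =>
    have hi := simple_mem_coxeterParabolic M (hω i (by simp))
    intro t ht
    rw [CoxeterSystem.leftInvSeq, List.mem_cons, List.mem_map] at ht
    obtain rfl | ⟨u, hu, rfl⟩ := ht
    · exact hi
    · rw [MulAut.conj_apply]
      exact mul_mem (mul_mem hi (ih (fun j hj => hω j (by simp [hj])) u hu)) (inv_mem hi)

theorem exists_word_of_mem_coxeterParabolic (M : CoxeterMatrix I) {X : Set I} {w : M.Group}
    (hw : w ∈ coxeterParabolic M X) :
    ∃ ω : List I, (∀ i ∈ ω, i ∈ X) ∧ M.toCoxeterSystem.wordProd ω = w := by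
  induction hw using Subgroup.closure_induction with
  | mem w hw =>
    obtain ⟨x, hx, rfl⟩ := hw
    exact ⟨[x], by simpa using hx, by simp⟩
  | one => exact ⟨[], by simp, by simp⟩
  | mul u v _ _ hu hv =>
    obtain ⟨a, ha, rfl⟩ := hu
    obtain ⟨b, hb, rfl⟩ := hv
    refine ⟨a ++ b, fun i hi => ?_, CoxeterSystem.wordProd_append _ a b⟩
    exact (List.mem_append.1 hi).elim (ha i) (hb i)
  | inv u _ hu =>
    obtain ⟨a, ha, rfl⟩ := hu
    exact ⟨a.reverse, by simpa using ha, by simp⟩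

/-- Every element of `W_X` has a word on `X` whose left inversion sequence has no repetition. -/
theorem exists_nodup_word_of_mem_coxeterParabolic (M : CoxeterMatrix I) {X : Set I} {w : M.Group}
    (hw : w ∈ coxeterParabolic M X) :
    ∃ ω : List I, (∀ i ∈ ω, i ∈ X) ∧ M.toCoxeterSystem.wordProd ω = w ∧
      (M.toCoxeterSystem.leftInvSeq ω).Nodup := by
  -- Minimality is among words on `X` only, so it need not be known that a word reduced on `X` is
  -- reduced in `W_I`.
  obtain ⟨ω, ⟨hX, hω⟩, hmin⟩ := exists_minimalFor_of_wellFoundedLT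
    (fun ω : List I => (∀ i ∈ ω, i ∈ X) ∧ M.toCoxeterSystem.wordProd ω = w) List.length
    (exists_word_of_mem_coxeterParabolic M hw)
  refine ⟨ω, hX, hω, ?_⟩
  rw [List.nodup_iff_injective_get]
  by_contra hinj
  obtain ⟨a, b, hab, hlt⟩ : ∃ a b, (M.toCoxeterSystem.leftInvSeq ω).get a =
      (M.toCoxeterSystem.leftInvSeq ω).get b ∧ a < b := by
    simp only [Function.Injective, not_forall] at hinj
    obtain ⟨a, b, hab, hne⟩ := hinj
    rcases lt_or_gt_of_ne hne with h | h
    · exact ⟨a, b, hab, h⟩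
    · exact ⟨b, a, hab.symm, h⟩
  simp only [List.get_eq_getElem] at hab
  have ha : (a : ℕ) < ω.length := by simpa using a.2
  have hb : (b : ℕ) < ω.length := by simpa using b.2
  have hlt' : (a : ℕ) < b := hlt
  have h1 := M.toCoxeterSystem.getD_leftInvSeq_mul_wordProd ω b
  -- Deleting the letter at `b`, then the one at `a < b`, multiplies the product on the left by two
  -- equal reflections. The product is unchanged and the word is shorter.
  have h2 := M.toCoxeterSystem.getD_leftInvSeq_mul_wordProd (ω.eraseIdx b) a
  have h3 : (M.toCoxeterSystem.leftInvSeq (ω.eraseIdx b)).getD a 1 =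
      (M.toCoxeterSystem.leftInvSeq ω).getD a 1 := by
    rw [CoxeterSystem.getD_leftInvSeq, CoxeterSystem.getD_leftInvSeq,
      List.take_eraseIdx_eq_take_of_le _ _ _ hlt'.le, List.getElem?_eraseIdx_of_lt hlt']
  have h4 : (M.toCoxeterSystem.leftInvSeq ω).getD a 1 =
      (M.toCoxeterSystem.leftInvSeq ω).getD b 1 := by
    rw [List.getD_eq_getElem _ _ a.2, List.getD_eq_getElem _ _ b.2, hab]
  rw [h3, h4, ← h1, ← mul_assoc, CoxeterSystem.getD_leftInvSeq_mul_self, one_mul] at h2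
  have hsub : ∀ i ∈ (ω.eraseIdx b).eraseIdx a, i ∈ X := fun i hi =>
    hX i (List.mem_of_mem_eraseIdx (List.mem_of_mem_eraseIdx hi))
  have hlen : ((ω.eraseIdx b).eraseIdx a).length + 2 = ω.length := by
    rw [← List.length_eraseIdx_add_one hb, ← List.length_eraseIdx_add_one (l := ω.eraseIdx b)]
    rw [List.length_eraseIdx_of_lt hb]
    omega
  have := hmin ⟨hsub, h2.symm.trans hω⟩ (by omega)
  omega

theorem mem_coxeterParabolic_of_parity_ne_zero (M : CoxeterMatrix I) {X : Set I} {w t : M.Group}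
    (hw : w ∈ coxeterParabolic M X) (ht : parity M w t ≠ 0) : t ∈ coxeterParabolic M X := by
  classical
  obtain ⟨ω, hω, rfl⟩ := exists_word_of_mem_coxeterParabolic M hw
  rw [parity_wordProd] at ht
  refine leftInvSeq_subset_coxeterParabolic M hω t (List.count_pos_iff.1 (Nat.pos_of_ne_zero ?_))
  rintro h
  simp [h] at ht

/-- An element of `W_X` which is its own unique inversion is a simple reflection of `W_X`. -/
theorem exists_eq_simple_of_parity (M : CoxeterMatrix I) {X : Set I} {r : M.Group}
    (hr : r ∈ coxeterParabolic M X) (h1 : parity M r r = 1) (h : ∀ t, parity M r t ≠ 0 → t = r) :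
    ∃ x ∈ X, r = M.simple x := by
  classical
  obtain ⟨ω, hX, rfl, hnd⟩ := exists_nodup_word_of_mem_coxeterParabolic M hr
  have hall : ∀ t ∈ M.toCoxeterSystem.leftInvSeq ω, t = M.toCoxeterSystem.wordProd ω := by
    intro t ht
    apply h
    rw [parity_wordProd, List.count_eq_one_of_mem hnd ht]
    simp
  match ω, hX, h1, hnd, hall with
  | [], _, h1, _, _ => simp [parity_one] at h1
  | [i], hX, _, _, _ => exact ⟨i, hX i (by simp), by simp⟩
  | i :: j :: ω, _, _, hnd, hall =>
    exfalso
    simp only [CoxeterSystem.leftInvSeq, List.map_cons] at hnd hall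
    have h2 := (hall _ List.mem_cons_self).trans (hall _ (List.mem_cons_of_mem _ (List.mem_cons_self))).symm
    rw [List.nodup_cons] at hnd
    exact hnd.1 (h2 ▸ List.mem_cons_self)

theorem coxeterParabolic_mono (M : CoxeterMatrix I) {X Y : Set I} (h : X ⊆ Y) :
    coxeterParabolic M X ≤ coxeterParabolic M Y :=
  Subgroup.closure_mono (Set.image_mono h)

theorem simple_mem_coxeterParabolic_iff (M : CoxeterMatrix I) {X : Set I} {i : I} :
    M.simple i ∈ coxeterParabolic M X ↔ i ∈ X := by
  refine ⟨fun h => ?_, simple_mem_coxeterParabolic M⟩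
  obtain ⟨x, hx, hix⟩ := exists_eq_simple_of_parity M h (by rw [parity_simple, if_pos rfl])
    (fun t ht => by
      rw [parity_simple] at ht
      by_contra hne
      exact ht (if_neg hne))
  rwa [simple_injective M hix]

/-- In a repetition-free word on `X` for `w`, the first letter is an inversion of `w`. As `w ∈ W_Y`,
that letter lies in `Y`; remove it and repeat. -/
theorem coxeterParabolic_inter (M : CoxeterMatrix I) (X Y : Set I) :
    coxeterParabolic M X ⊓ coxeterParabolic M Y = coxeterParabolic M (X ∩ Y) := by
  classical
  refine le_antisymm ?_ (le_inf (coxeterParabolic_mono M Set.inter_subset_left)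
    (coxeterParabolic_mono M Set.inter_subset_right))
  rintro w ⟨hX, hY⟩
  obtain ⟨ω, hω, rfl, hnd⟩ := exists_nodup_word_of_mem_coxeterParabolic M hX
  clear hX
  induction ω with
  | nil => simp [one_mem]
  | cons i ω ih =>
    have hi : i ∈ Y := by
      rw [← simple_mem_coxeterParabolic_iff M]
      apply mem_coxeterParabolic_of_parity_ne_zero M hY
      rw [parity_wordProd, List.count_eq_one_of_mem hnd (by simp [CoxeterSystem.leftInvSeq])]
      simp
    rw [CoxeterSystem.wordProd_cons] at hY ⊢
    refine mul_mem (simple_mem_coxeterParabolic M ⟨hω i (by simp), hi⟩)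
      (ih (fun j hj => hω j (by simp [hj])) ?_ ?_)
    · exact (List.nodup_cons.1 hnd).2.of_map
    · exact (Subgroup.mul_mem_cancel_left _ (simple_mem_coxeterParabolic M hi)).1 hY

end Parabolic

/-! ### Words, signed reflections and alternating products -/

section Words

theorem signedReflections_nil (M : CoxeterMatrix I) : signedReflections M [] = [] := rfl

/-- Conjugation by `w` on the first component of a signed group element. -/
def conjSigned {G : Type*} [Group G] (w : G) (p : G × Bool) : G × Bool :=
  (w * p.1 * w⁻¹, p.2)

theorem conjSigned_mul {G : Type*} [Group G] (u v : G) :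
    conjSigned (u * v) = conjSigned u ∘ conjSigned v := by
  funext p; simp [conjSigned, mul_assoc]

theorem conjSigned_one {G : Type*} [Group G] : conjSigned (1 : G) = id := by
  funext p; simp [conjSigned]

theorem conjSigned_injective {G : Type*} [Group G] (w : G) :
    Function.Injective (conjSigned w) := by
  rintro ⟨a, b⟩ ⟨c, d⟩ h
  simpa [conjSigned] using h

theorem signedReflections_cons (M : CoxeterMatrix I) (i : I) (b : Bool) (ω : List (I × Bool)) :
    signedReflections M ((i, b) :: ω) =
      (M.simple i, b) :: (signedReflections M ω).map (conjSigned (M.simple i)) := by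
  simp only [signedReflections, List.map_cons, CoxeterSystem.leftInvSeq, List.zip_cons_cons,
    List.zip_map_left]
  rfl

theorem length_signedReflections (M : CoxeterMatrix I) (ω : List (I × Bool)) :
    (signedReflections M ω).length = ω.length := by
  simp [signedReflections]

/-- A word is determined by its sequence of signed reflections. -/
theorem signedReflections_injective (M : CoxeterMatrix I) :
    Function.Injective (signedReflections M) := by
  intro ω
  induction ω with
  | nil =>
    intro ω' h
    have := congrArg List.length h
    rw [length_signedReflections, length_signedReflections] at this
    exact (List.length_eq_zero_iff.1 this.symm).symm
  | cons a ω ih =>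
    rintro (_ | ⟨a', ω'⟩) h
    · have := congrArg List.length h
      simp [length_signedReflections] at this
    · rw [signedReflections_cons, signedReflections_cons, List.cons.injEq, Prod.mk.injEq] at h
      obtain ⟨⟨h1, h2⟩, h3⟩ := h
      have h1 := simple_injective M h1
      rw [h1] at h3
      rw [ih ((List.map_injective_iff.2 (conjSigned_injective _)) h3), Prod.ext h1 h2]

/-- The word `σ_i σ_j σ_i ⋯` with `n` letters. -/
def altWord (i j : I) : ℕ → List (I × Bool)
  | 0 => []
  | n + 1 => (i, true) :: altWord j i n

theorem signedReflections_altWord (M : CoxeterMatrix I) (n : ℕ) : ∀ i j : I,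
    signedReflections M (altWord i j n) =
      (List.range n).map fun k => ((M.simple i * M.simple j) ^ k * M.simple i, true) := by
  induction n with
  | zero => intro i j; rfl
  | succ n ih =>
    intro i j
    rw [altWord, signedReflections_cons, ih, List.range_succ_eq_map, List.map_cons, List.map_map,
      List.map_map]
    refine congrArg₂ _ (by simp) (List.map_congr_left fun k _ => ?_)
    simp only [Function.comp_apply, conjSigned, simple_inv, Nat.succ_eq_add_one, Prod.mk.injEq,
      and_true]
    rw [← mul_assoc, simple_mul_pow_comm, pow_succ]
    simp only [mul_assoc]

/-- The value of a word on the letters `σ_i`, `σ_i⁻¹` when `σ_i` is sent to `g i`. -/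
def evalIn {G : Type*} [Group G] (g : I → G) (ω : List (I × Bool)) : G :=
  (ω.map fun a => if a.2 then g a.1 else (g a.1)⁻¹).prod

theorem evalIn_gen (M : CoxeterMatrix I) : evalIn (gen M) = eval M := rfl

theorem evalIn_cons {G : Type*} [Group G] (g : I → G) (i : I) (b : Bool) (ω : List (I × Bool)) :
    evalIn g ((i, b) :: ω) = (if b then g i else (g i)⁻¹) * evalIn g ω := by
  simp [evalIn]

theorem evalIn_altWord {G : Type*} [Group G] (g : I → G) (n : ℕ) : ∀ i j : I,
    evalIn g (altWord i j n) = altProd (g i) (g j) n := by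
  induction n with
  | zero => intro i j; rfl
  | succ n ih => intro i j; rw [altWord, evalIn_cons, ih]; rfl

theorem map_evalIn {G H : Type*} [Group G] [Group H] (f : G →* H) (g : I → G)
    (ω : List (I × Bool)) : f (evalIn g ω) = evalIn (fun i => f (g i)) ω := by
  induction ω with
  | nil => exact map_one f
  | cons a ω ih =>
    rw [evalIn_cons, evalIn_cons, map_mul, ih]
    split <;> simp

theorem altProd_mul_altProd_inv {G : Type*} [Group G] (n : ℕ) : ∀ {a b : G},
    a * a = 1 → b * b = 1 → altProd a b n * (altProd b a n)⁻¹ = (a * b) ^ n := by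
  induction n with
  | zero => intro a b _ _; simp [altProd]
  | succ n ih =>
    intro a b ha hb
    have hb' : b⁻¹ = b := inv_eq_of_mul_eq_one_left hb
    have h : SemiconjBy a (b * a) (a * b) := (mul_assoc a b a).symm
    calc altProd a b (n + 1) * (altProd b a (n + 1))⁻¹
        = a * (altProd b a n * (altProd a b n)⁻¹) * b⁻¹ := by
          simp only [altProd, mul_inv_rev, mul_assoc]
      _ = (a * b) ^ (n + 1) := by
          rw [ih hb ha, (h.pow_right n).eq, hb', pow_succ, mul_assoc]

/-- For involutions the braid relation and the Coxeter relation are equivalent, so one argument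
serves both kinds of group. -/
theorem altProd_eq_iff {G : Type*} [Group G] {a b : G} (ha : a * a = 1) (hb : b * b = 1) (n : ℕ) :
    altProd a b n = altProd b a n ↔ (a * b) ^ n = 1 := by
  rw [← altProd_mul_altProd_inv n ha hb, mul_inv_eq_one]

theorem altProd_simple (M : CoxeterMatrix I) (i j : I) :
    altProd (M.simple i) (M.simple j) (M i j) = altProd (M.simple j) (M.simple i) (M i j) :=
  (altProd_eq_iff (simple_mul_self M i) (simple_mul_self M j) _).2
    (M.toCoxeterSystem.simple_mul_simple_pow i j)

/-- A word on the letters `σ_x^{±1}`, `x ∈ X`, seen as a word on all letters. -/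
def inclWord {X : Set I} (η : List (X × Bool)) : List (I × Bool) :=
  η.map fun a => ((a.1 : I), a.2)

theorem inclWord_injective {X : Set I} : Function.Injective (inclWord (X := X)) := by
  apply List.map_injective_iff.2
  rintro ⟨a, b⟩ ⟨c, d⟩ h
  simpa [Subtype.ext_iff] using h

theorem inclWord_altWord {X : Set I} (n : ℕ) : ∀ x y : X,
    inclWord (altWord x y n) = altWord (x : I) y n := by
  induction n with
  | zero => intro x y; rfl
  | succ n ih => intro x y; exact congrArg _ (ih y x)

theorem evalIn_inclWord {G : Type*} [Group G] {X : Set I} (g : I → G) (η : List (X × Bool)) :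
    evalIn g (inclWord η) = evalIn (fun x : X => g x) η := by
  simp [evalIn, inclWord, Function.comp_def]

theorem incl_gen (M : CoxeterMatrix I) (X : Set I) (x : X) :
    incl M X (gen (restrict M X) x) = gen M x :=
  PresentedGroup.toGroup.of _

theorem incl_eval (M : CoxeterMatrix I) (X : Set I) (η : List (X × Bool)) :
    incl M X (eval (restrict M X) η) = eval M (inclWord η) := by
  rw [← evalIn_gen, map_evalIn, ← evalIn_gen, evalIn_inclWord]
  simp only [incl_gen]

theorem isRetractWord_unique (M : CoxeterMatrix I) (X : Set I) (ω : List (I × Bool))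
    {η η' : List (X × Bool)} (h : IsRetractWord M X ω η) (h' : IsRetractWord M X ω η') :
    η = η' :=
  inclWord_injective (signedReflections_injective M (h.trans h'.symm))

end Words

/-! ### The transducer on minimal coset representatives -/

section Scan

open Classical

variable (M : CoxeterMatrix I) (X : Set I)

/-- The elements of `W_I` without inversion in `W_X`, that is, the minimal representatives of the
cosets `W_X w`. -/
abbrev MinimalRep : Type _ := {w : M.Group // ∀ t ∈ coxeterParabolic M X, parity M w t = 0}

variable {M X}

/-- The coset representative `1`. -/
def MinimalRep.one : MinimalRep M X := ⟨1, fun t _ => parity_one M t⟩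

/-- Write `r = w s_i w⁻¹` and compute the inversions of `r w = w s_i` lying in `W_X` in two ways. As
`w` has none, `r` is the only one of `r`, hence a simple reflection of `W_X`. -/
theorem MinimalRep.exists_simple (w : MinimalRep M X) (i : I)
    (h : w.1 * M.simple i * w.1⁻¹ ∈ coxeterParabolic M X) :
    ∃ x : X, w.1 * M.simple i * w.1⁻¹ = M.simple x := by
  set r := w.1 * M.simple i * w.1⁻¹ with hr
  have hrr : r * r = 1 := by
    have := simple_mul_self M i
    rw [hr]
    simp [mul_assoc, simple_mul_cancel_left]
  have hrw : r * w.1 = w.1 * M.simple i := by rw [hr]; group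
  have key : ∀ t ∈ coxeterParabolic M X, parity M r t = if t = r then 1 else 0 := by
    intro t ht
    have h1 := parity_mul M r w.1 t
    rw [hrw, parity_mul, w.2 t ht, w.2 _ (mul_mem (mul_mem (inv_mem h) ht) h), add_zero, zero_add,
      parity_simple] at h1
    rw [← h1]
    refine if_congr ?_ rfl rfl
    rw [hr, eq_mul_inv_iff_mul_eq, mul_assoc, inv_mul_eq_iff_eq_mul]
  obtain ⟨x, hx, hx'⟩ := exists_eq_simple_of_parity M h (by rw [key r h, if_pos rfl])
    (fun t ht => by
      rw [key t (mem_coxeterParabolic_of_parity_ne_zero M h ht)] at ht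
      by_contra hne
      exact ht (if_neg hne))
  exact ⟨⟨x, hx⟩, hx'⟩

/-- The coset representative obtained by reading the letter `i`. -/
noncomputable def MinimalRep.next (w : MinimalRep M X) (i : I) : MinimalRep M X :=
  if h : w.1 * M.simple i * w.1⁻¹ ∈ coxeterParabolic M X then w else
    ⟨w.1 * M.simple i, fun t ht => by
      rw [parity_mul, w.2 t ht, zero_add, parity_simple, if_neg]
      intro h'
      apply h
      rw [← h']
      convert ht using 1
      group⟩

/-- The element of `X` produced by reading the letter `i`, if there is one. -/
noncomputable def MinimalRep.output (w : MinimalRep M X) (i : I) : Option X :=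
  if h : ∃ x : X, w.1 * M.simple i * w.1⁻¹ = M.simple x then some h.choose else none

/-- The word on `X` produced by reading the word `ω` from the coset representative `w`. -/
noncomputable def MinimalRep.scan (w : MinimalRep M X) : List (I × Bool) → List (X × Bool)
  | [] => []
  | (i, b) :: ω => (match w.output i with
      | some x => [(x, b)]
      | none => []) ++ (w.next i).scan ω

/-- The coset representative obtained by reading the word `ω` from `w`. -/
noncomputable def MinimalRep.last (w : MinimalRep M X) : List (I × Bool) → MinimalRep M X
  | [] => w
  | (i, _) :: ω => (w.next i).last ω

theorem MinimalRep.cases (w : MinimalRep M X) (i : I) :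
    (∃ x : X, w.1 * M.simple i * w.1⁻¹ = M.simple x ∧ w.output i = some x ∧ w.next i = w) ∨
      (w.1 * M.simple i * w.1⁻¹ ∉ coxeterParabolic M X ∧ w.output i = none ∧
        (w.next i).1 = w.1 * M.simple i) := by
  by_cases h : w.1 * M.simple i * w.1⁻¹ ∈ coxeterParabolic M X
  · left
    have hx := w.exists_simple i h
    exact ⟨hx.choose, hx.choose_spec, dif_pos hx, dif_pos h⟩
  · right
    refine ⟨h, dif_neg ?_, ?_⟩
    · rintro ⟨x, hx⟩
      exact h (hx ▸ simple_mem_coxeterParabolic M x.2)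
    · rw [MinimalRep.next, dif_neg h]

/-- Together with `MinimalRep.output_next`, this makes reading a letter an invertible operation,
with `σ_i⁻¹` acting as the inverse of `σ_i`. -/
theorem MinimalRep.next_next (w : MinimalRep M X) (i : I) : (w.next i).next i = w := by
  rcases w.cases i with ⟨x, -, -, h⟩ | ⟨h1, -, h2⟩
  · rw [h, h]
  · have h3 : (w.next i).1 * M.simple i * (w.next i).1⁻¹ = w.1 * M.simple i * w.1⁻¹ := by
      rw [h2]; group
    rw [MinimalRep.next, dif_neg (h3 ▸ h1)]
    apply Subtype.ext
    change (w.next i).1 * M.simple i = w.1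
    rw [h2, mul_assoc, simple_mul_self, mul_one]

theorem MinimalRep.output_next (w : MinimalRep M X) (i : I) :
    (w.next i).output i = w.output i := by
  rcases w.cases i with ⟨x, -, -, h⟩ | ⟨-, -, h2⟩
  · rw [h]
  · have h3 : (w.next i).1 * M.simple i * (w.next i).1⁻¹ = w.1 * M.simple i * w.1⁻¹ := by
      rw [h2]; group
    simp only [MinimalRep.output, h3]

/-- The signed reflections of the word produced by reading `ω` are those lying in `W_X`. -/
theorem MinimalRep.signedReflections_scan (ω : List (I × Bool)) : ∀ w : MinimalRep M X,
    signedReflections M (inclWord (w.scan ω)) =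
      ((signedReflections M ω).map (conjSigned w.1)).filter
        fun p => p.1 ∈ coxeterParabolic M X := by
  induction ω with
  | nil => intro w; rfl
  | cons a ω ih =>
    obtain ⟨i, b⟩ := a
    intro w
    rw [signedReflections_cons, List.map_cons, List.map_map, ← conjSigned_mul]
    rcases w.cases i with ⟨x, hx, ho, hn⟩ | ⟨hi, ho, hn⟩
    · have hxm := simple_mem_coxeterParabolic M x.2
      have hwx : w.1 * M.simple i = M.simple x * w.1 := by rw [← hx]; group
      rw [MinimalRep.scan, ho, hn]
      change signedReflections M (((x : I), b) :: inclWord (w.scan ω)) = _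
      rw [signedReflections_cons, ih, hwx, conjSigned_mul, ← List.map_map,
        List.filter_cons_of_pos (by simpa [conjSigned, hx] using hxm),
        List.filter_map (f := conjSigned (M.simple x))]
      congr 1
      · simp [conjSigned, hx]
      · congr 1
        -- Conjugation by `s_x ∈ W_X` preserves membership in `W_X`, so it commutes with the filter.
        apply List.filter_congr
        intro p _
        apply decide_eq_decide.2
        change _ ↔ M.simple x * p.1 * (M.simple x)⁻¹ ∈ coxeterParabolic M X
        rw [Subgroup.mul_mem_cancel_right _ (inv_mem hxm), Subgroup.mul_mem_cancel_left _ hxm]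
    · rw [MinimalRep.scan, ho, List.filter_cons_of_neg (by
          rw [decide_eq_true_eq]; exact hi),
        List.nil_append, ih, hn]

/-- The final state is determined by the images in `W_I` of the input and of the output. Hence the
final states need no separate check on braid relations. -/
theorem MinimalRep.evalIn_scan_mul_last (ω : List (I × Bool)) : ∀ w : MinimalRep M X,
    evalIn M.simple (inclWord (w.scan ω)) * (w.last ω).1 = w.1 * evalIn M.simple ω := by
  induction ω with
  | nil => intro w; simp [MinimalRep.scan, MinimalRep.last, evalIn, inclWord]
  | cons a ω ih =>
    obtain ⟨i, b⟩ := a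
    intro w
    have hb (i : I) : (if b then M.simple i else (M.simple i)⁻¹) = M.simple i := by
      rw [simple_inv, ite_self]
    rw [evalIn_cons, hb, MinimalRep.scan, MinimalRep.last]
    rcases w.cases i with ⟨x, hx, ho, hn⟩ | ⟨hi, ho, hn⟩
    · rw [ho]
      change evalIn M.simple (((x : I), b) :: inclWord ((w.next i).scan ω)) * _ = _
      rw [evalIn_cons, hb, mul_assoc, ih, hn, ← hx]
      group
    · rw [ho, List.nil_append, ih, hn, mul_assoc]

theorem MinimalRep.isRetractWord_scan_one (ω : List (I × Bool)) :
    IsRetractWord M X ω ((MinimalRep.one : MinimalRep M X).scan ω) := by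
  have h := MinimalRep.signedReflections_scan ω (MinimalRep.one : MinimalRep M X)
  rw [show (MinimalRep.one : MinimalRep M X).1 = 1 from rfl, conjSigned_one, List.map_id] at h
  exact h

theorem isRetractWord_piWord (ω : List (I × Bool)) : IsRetractWord M X ω (piWord M X ω) := by
  have h : ∃ η, IsRetractWord M X ω η := ⟨_, MinimalRep.isRetractWord_scan_one ω⟩
  rw [piWord, dif_pos h]
  exact h.choose_spec

theorem piWord_eq_scan (ω : List (I × Bool)) :
    piWord M X ω = (MinimalRep.one : MinimalRep M X).scan ω :=
  isRetractWord_unique M X ω (isRetractWord_piWord ω) (MinimalRep.isRetractWord_scan_one ω)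

theorem signedReflections_piWord (ω : List (I × Bool)) :
    signedReflections M (inclWord (piWord M X ω)) =
      (signedReflections M ω).filter fun p => p.1 ∈ coxeterParabolic M X :=
  isRetractWord_piWord ω

end Scan

/-! ### Braid relations through the transducer -/

section Braid

theorem filter_range_mul {d k₀ : ℕ} (hk₀ : k₀ < d) (f : ℕ → Bool)
    (hf : ∀ k : ℕ, f k = true ↔ (d : ℤ) ∣ k - k₀) (p : ℕ) :
    (List.range (d * p)).filter f = (List.range p).map fun n => k₀ + d * n := by
  induction p with
  | zero => simp
  | succ p ih =>
    rw [mul_add, mul_one, List.range_add, List.filter_append, ih, List.range_succ, List.map_append,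
      List.filter_map]
    have h : (List.range d).filter (f ∘ fun x => d * p + x) = (List.range d).filter (· == k₀) := by
      apply List.filter_congr
      intro k hk
      rw [List.mem_range] at hk
      rw [Bool.eq_iff_iff, Function.comp_apply, hf, beq_iff_eq]
      push_cast
      rw [add_sub_assoc, Int.dvd_add_right (dvd_mul_right _ _)]
      constructor
      · intro hd
        have := Int.eq_zero_of_abs_lt_dvd hd (by rw [abs_lt]; omega)
        omega
      · rintro rfl
        simp
    rw [h, List.filter_beq, List.count_eq_one_of_mem List.nodup_range (List.mem_range.2 hk₀)]
    simp [add_comm]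

/-- The exponents `k` with `ρ ^ k * s ∈ H` form either the empty set or an arithmetic
progression. -/
theorem forall_notMem_or_exists_dvd_iff {G : Type*} [Group G] (H : Subgroup G) (ρ s : G) {m : ℕ}
    (hm : m ≠ 0) (hρ : ρ ^ m = 1) :
    (∀ k : ℤ, ρ ^ k * s ∉ H) ∨ ∃ d p k₀ : ℕ, d * p = m ∧ k₀ < d ∧
      ∀ k : ℤ, ρ ^ k * s ∈ H ↔ (d : ℤ) ∣ k - k₀ := by
  by_cases h : ∃ k : ℤ, ρ ^ k * s ∈ H
  swap
  · exact Or.inl (not_exists.1 h)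
  right
  obtain ⟨k₁, hk₁⟩ := h
  -- The solutions `k` form a coset of the group of exponents `δ` with `ρ ^ δ ∈ H`. This group
  -- contains `m`, so its generator `d` divides `m`.
  let D : AddSubgroup ℤ :=
    { carrier := {δ | ρ ^ δ ∈ H}
      zero_mem' := by simp [one_mem]
      add_mem' := fun {a b} ha hb => by
        simp only [Set.mem_ofPred_eq] at ha hb ⊢
        rw [zpow_add]; exact mul_mem ha hb
      neg_mem' := fun {a} ha => by
        simp only [Set.mem_ofPred_eq] at ha ⊢
        rw [zpow_neg]; exact inv_mem ha }
  obtain ⟨a, ha⟩ := Int.subgroup_cyclic D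
  have hD (δ : ℤ) : ρ ^ δ ∈ H ↔ (a.natAbs : ℤ) ∣ δ := by
    rw [Int.natAbs_dvd]
    change δ ∈ D ↔ _
    rw [ha, ← AddSubgroup.zmultiples_eq_closure, Int.mem_zmultiples_iff]
  have hdm : a.natAbs ∣ m := by
    rw [← Int.natCast_dvd_natCast, ← hD, zpow_natCast, hρ]
    exact one_mem H
  obtain ⟨p, hp⟩ := hdm
  have hd : (0 : ℤ) < a.natAbs := by
    rcases Nat.eq_zero_or_pos a.natAbs with h | h
    · rw [h, zero_mul] at hp
      exact absurd hp hm
    · exact_mod_cast h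
  refine ⟨a.natAbs, p, (k₁ % a.natAbs).toNat, hp.symm, ?_, fun k => ?_⟩
  · have h1 := Int.emod_lt_of_pos k₁ hd
    have h2 := Int.emod_nonneg k₁ hd.ne'
    omega
  · rw [Int.toNat_of_nonneg (Int.emod_nonneg k₁ hd.ne')]
    have h1 : ρ ^ k * s = ρ ^ (k - k₁) * (ρ ^ k₁ * s) := by
      rw [← mul_assoc, ← zpow_add, sub_add_cancel]
    rw [h1, Subgroup.mul_mem_cancel_right _ hk₁, hD]
    have h2 : k - k₁ % a.natAbs = (k - k₁) + a.natAbs * (k₁ / a.natAbs) := by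
      have := Int.emod_add_mul_ediv k₁ a.natAbs
      linarith
    rw [h2, Int.dvd_add_left (dvd_mul_right _ _)]

variable {M : CoxeterMatrix I} {X : Set I}

open Classical in
theorem MinimalRep.signedReflections_scan_altWord (w : MinimalRep M X) (i j : I) (n : ℕ) :
    signedReflections M (inclWord (w.scan (altWord i j n))) =
      ((List.range n).filter fun k =>
          w.1 * ((M.simple i * M.simple j) ^ k * M.simple i) * w.1⁻¹ ∈ coxeterParabolic M X).map
        fun k => (w.1 * ((M.simple i * M.simple j) ^ k * M.simple i) * w.1⁻¹, true) := by
  rw [MinimalRep.signedReflections_scan, signedReflections_altWord, List.map_map, List.filter_map]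
  rfl

theorem MinimalRep.scan_altWord_eq_nil (w : MinimalRep M X) (i j : I) (n : ℕ)
    (h : ∀ k : ℕ,
      w.1 * ((M.simple i * M.simple j) ^ k * M.simple i) * w.1⁻¹ ∉ coxeterParabolic M X) :
    w.scan (altWord i j n) = [] := by
  have h1 := w.signedReflections_scan_altWord i j n
  rw [List.filter_eq_nil_iff.2 (by simpa using fun k _ => h k)] at h1
  have h2 := congrArg List.length h1
  rw [length_signedReflections] at h2
  simpa [inclWord] using h2

/-- Reading the two sides of a braid relation produces either nothing or the two sides of a braid
relation. -/
theorem MinimalRep.scan_braid (w : MinimalRep M X) {i j : I} (hm : M i j ≠ 0) :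
    (w.scan (altWord i j (M i j)) = [] ∧ w.scan (altWord j i (M i j)) = []) ∨
      ∃ x y : X, w.scan (altWord i j (M i j)) = altWord x y (M x y) ∧
        w.scan (altWord j i (M i j)) = altWord y x (M x y) := by
  classical
  set m := M i j with hmdef
  set ρ := M.simple i * M.simple j with hρ
  have hρm : orderOf ρ = m := orderOf_simple_mul_simple M i j
  have hρ1 : ρ ^ m = 1 := hρm ▸ pow_orderOf_eq_one ρ
  set H : Subgroup M.Group := (coxeterParabolic M X).comap (MulAut.conj w.1).toMonoidHom
  have hHmem (g : M.Group) : g ∈ H ↔ w.1 * g * w.1⁻¹ ∈ coxeterParabolic M X := Iff.rfl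
  have hij (k : ℕ) : (M.simple i * M.simple j) ^ k * M.simple i = ρ ^ (k : ℤ) * M.simple i := by
    rw [zpow_natCast]
  -- The other side of the relation runs through the same reflections backwards, starting at
  -- exponent `-1`.
  have hji (k : ℕ) : (M.simple j * M.simple i) ^ k * M.simple j =
      ρ ^ (-(k : ℤ) - 1) * M.simple i := by
    rw [zpow_sub, zpow_neg, zpow_natCast, ← inv_pow, zpow_one, hρ, simple_mul_simple_inv]
    simp only [mul_assoc, simple_mul_self, mul_one]
  rcases forall_notMem_or_exists_dvd_iff H ρ (M.simple i) hm hρ1 with h | ⟨d, p, k₀, hdp, hk₀, h⟩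
  · left
    constructor <;> apply MinimalRep.scan_altWord_eq_nil
    · intro k; rw [hij]; exact h _
    · intro k; rw [hji]; exact h _
  right
  set θ := w.1 * ρ ^ d * w.1⁻¹ with hθ
  set r := w.1 * (ρ ^ k₀ * M.simple i) * w.1⁻¹ with hr
  have hp : p ≠ 0 := by rintro rfl; exact hm (by rw [← hdp, mul_zero])
  have hd : d ≠ 0 := by omega
  have hθz (n : ℤ) : θ ^ n * r = w.1 * (ρ ^ (k₀ + d * n) * M.simple i) * w.1⁻¹ := by
    rw [hθ, conj_zpow, hr, add_comm (k₀ : ℤ), zpow_add, zpow_mul, zpow_natCast, zpow_natCast]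
    group
  have hθp : orderOf θ = p := by
    have h1 : orderOf θ = orderOf (ρ ^ d) :=
      orderOf_injective (MulAut.conj w.1).toMonoidHom (MulAut.conj w.1).injective (ρ ^ d)
    rw [h1, orderOf_pow_of_dvd hd (hρm ▸ ⟨p, hdp.symm⟩), hρm, ← hdp,
      Nat.mul_div_cancel_left _ (Nat.pos_of_ne_zero hd)]
  have s1 : signedReflections M (inclWord (w.scan (altWord i j m))) =
      (List.range p).map fun n => (θ ^ n * r, true) := by
    rw [MinimalRep.signedReflections_scan_altWord]
    conv_lhs => rw [← hdp]
    rw [filter_range_mul hk₀ _ (fun k => by rw [decide_eq_true_eq, hij, ← hHmem, h]), List.map_map]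
    refine List.map_congr_left fun n _ => ?_
    rw [Function.comp_apply, hij, ← zpow_natCast θ, hθz]
    push_cast
    rfl
  have s2 : signedReflections M (inclWord (w.scan (altWord j i m))) =
      (List.range p).map fun n : ℕ => (θ ^ (-(n : ℤ) - 1) * r, true) := by
    rw [MinimalRep.signedReflections_scan_altWord]
    conv_lhs => rw [← hdp]
    -- The condition `-k - 1 ≡ k₀` modulo `d` has `d - 1 - k₀` as its solution in `[0, d)`.
    rw [filter_range_mul (k₀ := d - 1 - k₀) (by omega) _ (fun k => by
      rw [decide_eq_true_eq, hji, ← hHmem, h, ← dvd_neg]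
      rw [← Int.dvd_add_left (dvd_refl (d : ℤ))]
      rw [show -(-(k : ℤ) - 1 - k₀) = k - ((d - 1 - k₀ : ℕ) : ℤ) + d by omega]
      rw [Int.dvd_add_left (dvd_refl (d : ℤ)), Int.dvd_add_left (dvd_refl (d : ℤ))]), List.map_map]
    refine List.map_congr_left fun n _ => ?_
    rw [Function.comp_apply, hji, hθz]
    rw [show -((d - 1 - k₀ + d * n : ℕ) : ℤ) - 1 = k₀ + d * (-n - 1) by
      push_cast [show k₀ ≤ d - 1 by omega, show 1 ≤ d by omega]; ring]
  -- As `p > 0`, both outputs have a first letter, and its reflection is simple: this produces `x`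
  -- and `y`. Then `θ = s_x s_y` has order `p`, so `M x y = p`; for `p = 1` this means `x = y`.
  obtain ⟨q, rfl⟩ := Nat.exists_eq_succ_of_ne_zero hp
  rw [List.range_succ_eq_map] at s1 s2
  obtain ⟨x, hx⟩ : ∃ x : X, M.simple x = r := by
    rcases hs : w.scan (altWord i j m) with _ | ⟨⟨x, b⟩, η⟩
    · rw [hs] at s1; simp [inclWord, signedReflections_nil] at s1
    · rw [hs] at s1
      change signedReflections M (((x : I), b) :: inclWord η) = _ at s1
      rw [signedReflections_cons, List.map_cons, List.cons.injEq, Prod.mk.injEq] at s1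
      exact ⟨x, by simpa using s1.1.1⟩
  obtain ⟨y, hy⟩ : ∃ y : X, M.simple y = θ⁻¹ * r := by
    rcases hs : w.scan (altWord j i m) with _ | ⟨⟨y, b⟩, η⟩
    · rw [hs] at s2; simp [inclWord, signedReflections_nil] at s2
    · rw [hs] at s2
      change signedReflections M (((y : I), b) :: inclWord η) = _ at s2
      rw [signedReflections_cons, List.map_cons, List.cons.injEq, Prod.mk.injEq] at s2
      exact ⟨y, by simpa using s2.1.1⟩
  rw [← List.range_succ_eq_map] at s1 s2
  have hθxy : θ = M.simple x * M.simple y := by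
    rw [← hx] at hy
    rw [← simple_inv M y, hy, mul_inv_rev, inv_inv, mul_inv_cancel_left]
  have hMxy : M x y = q.succ := by rw [← hθp, hθxy, orderOf_simple_mul_simple]
  have hyx (n : ℕ) : (M.simple y * M.simple x) ^ n * M.simple y = θ ^ (-(n : ℤ) - 1) * r := by
    rw [zpow_sub, zpow_neg, zpow_natCast, ← inv_pow, zpow_one, mul_assoc, ← hy, hθxy,
      simple_mul_simple_inv]
  refine ⟨x, y, inclWord_injective (signedReflections_injective M ?_),
    inclWord_injective (signedReflections_injective M ?_)⟩
  · rw [s1, inclWord_altWord, signedReflections_altWord, hMxy, ← hθxy, hx]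
  · rw [s2, inclWord_altWord, signedReflections_altWord, hMxy]
    exact List.map_congr_left fun n _ => by rw [hyx]

end Braid

/-! ### The action on `A_X × (W_X \ W_I)` and the retraction -/

section Action

variable {M : CoxeterMatrix I} {X : Set I} {G : Type*} [Group G] (g : X → G)

/-- The permutation of `G × (W_X \ W_I)` obtained by reading the letter `i`. -/
noncomputable def readPerm (i : I) : Equiv.Perm (G × MinimalRep M X) where
  toFun p := (p.1 * (p.2.output i).elim 1 g, p.2.next i)
  invFun p := (p.1 * ((p.2.output i).elim 1 g)⁻¹, p.2.next i)
  left_inv p := by simp [MinimalRep.next_next, MinimalRep.output_next]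
  right_inv p := by simp [MinimalRep.next_next, MinimalRep.output_next]

/-- Words are read from left to right, so the letters act on the right; hence the opposite of the
permutation group. -/
theorem unop_evalIn_readPerm (ω : List (I × Bool)) : ∀ (a : G) (w : MinimalRep M X),
    (evalIn (fun i => MulOpposite.op (readPerm (M := M) g i)) ω).unop (a, w) =
      (a * evalIn g (w.scan ω), w.last ω) := by
  induction ω with
  | nil => intro a w; simp [evalIn, MinimalRep.scan, MinimalRep.last]
  | cons l ω ih =>
    obtain ⟨i, b⟩ := l
    intro a w
    rw [evalIn_cons, MulOpposite.unop_mul, Equiv.Perm.mul_apply]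
    have h : (if b then MulOpposite.op (readPerm (M := M) g i)
        else (MulOpposite.op (readPerm (M := M) g i))⁻¹).unop (a, w) =
        (a * (if b then (w.output i).elim 1 g else ((w.output i).elim 1 g)⁻¹), w.next i) := by
      cases b <;> rfl
    rw [h, ih, MinimalRep.scan, MinimalRep.last]
    rcases w.output i with _ | x
    · cases b <;> simp
    · simp only [List.cons_append, List.nil_append, evalIn_cons, Option.elim, mul_assoc]

theorem altProd_readPerm (hg : ∀ x y : X, altProd (g x) (g y) (M x y) =
    altProd (g y) (g x) (M x y)) {i j : I} (hm : M i j ≠ 0) :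
    altProd (MulOpposite.op (readPerm (M := M) g i)) (MulOpposite.op (readPerm g j)) (M i j) =
      altProd (MulOpposite.op (readPerm g j)) (MulOpposite.op (readPerm g i)) (M i j) := by
  have h (i j : I) (n : ℕ) := evalIn_altWord (fun i => MulOpposite.op (readPerm (M := M) g i)) n i j
  rw [← h i j, ← h j i]
  apply MulOpposite.unop_injective
  apply Equiv.ext
  rintro ⟨a, w⟩
  rw [unop_evalIn_readPerm, unop_evalIn_readPerm]
  have hlast (ω ω' : List (I × Bool))
      (h1 : evalIn M.simple (inclWord (w.scan ω)) = evalIn M.simple (inclWord (w.scan ω')))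
      (h2 : evalIn M.simple ω = evalIn M.simple ω') : w.last ω = w.last ω' := by
    have h3 := w.evalIn_scan_mul_last ω
    rw [h1, h2, ← w.evalIn_scan_mul_last ω'] at h3
    exact Subtype.ext (mul_left_cancel h3)
  have hW : evalIn M.simple (altWord i j (M i j)) = evalIn M.simple (altWord j i (M i j)) := by
    rw [evalIn_altWord, evalIn_altWord, altProd_simple]
  rcases w.scan_braid hm with ⟨h1, h2⟩ | ⟨x, y, h1, h2⟩
  · refine Prod.ext ?_ (hlast _ _ ?_ hW)
    · dsimp only; rw [h1, h2]
    · rw [h1, h2]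
  · refine Prod.ext ?_ (hlast _ _ ?_ hW)
    · dsimp only; rw [h1, h2, evalIn_altWord, evalIn_altWord, hg]
    · rw [h1, h2, inclWord_altWord, inclWord_altWord, evalIn_altWord, evalIn_altWord,
        altProd_simple]

/-- The right action of the Artin-Tits group on `A_X × (W_X \ W_I)`. -/
noncomputable def artinAction (M : CoxeterMatrix I) (X : Set I) :
    ArtinGroup M →* (Equiv.Perm (ArtinGroup (restrict M X) × MinimalRep M X))ᵐᵒᵖ :=
  PresentedGroup.toGroup
    (f := fun i => MulOpposite.op (readPerm (M := M) (gen (restrict M X)) i)) (by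
    rintro r ⟨i, j, -, hm, rfl⟩
    rw [map_mul, map_inv, mul_inv_eq_one, map_altProd, map_altProd, FreeGroup.lift_apply_of,
      FreeGroup.lift_apply_of]
    exact altProd_readPerm _ (altProd_gen (restrict M X)) hm)

theorem artinAction_eval (ω : List (I × Bool)) (a : ArtinGroup (restrict M X))
    (w : MinimalRep M X) :
    (artinAction M X (eval M ω)).unop (a, w) =
      (a * eval (restrict M X) (w.scan ω), w.last ω) := by
  rw [← evalIn_gen, map_evalIn]
  have h (i : I) : artinAction M X (gen M i) =
      MulOpposite.op (readPerm (M := M) (gen (restrict M X)) i) := PresentedGroup.toGroup.of _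
  simp only [h]
  exact unop_evalIn_readPerm _ ω a w

/-- The right-hand side involves no word, so the choice of a representative in `piMap` is
immaterial. -/
theorem piMap_eq_artinAction (a : ArtinGroup M) :
    piMap M X a = ((artinAction M X a).unop (1, MinimalRep.one)).1 := by
  rw [piMap, piWord_eq_scan]
  conv_rhs => rw [← Function.surjInv_eq (eval_surjective M) a, artinAction_eval, one_mul]

theorem piMap_eval (ω : List (I × Bool)) :
    piMap M X (eval M ω) = eval (restrict M X) (piWord M X ω) := by
  rw [piMap_eq_artinAction, artinAction_eval, one_mul, piWord_eq_scan]

theorem MinimalRep.one_output (x : X) : (MinimalRep.one : MinimalRep M X).output x = some x := by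
  have h1 : (MinimalRep.one : MinimalRep M X).1 * M.simple x *
      (MinimalRep.one : MinimalRep M X).1⁻¹ = M.simple x := by
    change 1 * _ * (1 : M.Group)⁻¹ = _
    group
  rcases (MinimalRep.one : MinimalRep M X).cases x with ⟨y, hy, ho, -⟩ | ⟨h, -, -⟩
  · rw [h1] at hy
    rw [ho, Subtype.ext (simple_injective M hy)]
  · rw [h1] at h
    exact absurd (simple_mem_coxeterParabolic M x.2) h

theorem MinimalRep.one_next (x : X) :
    (MinimalRep.one : MinimalRep M X).next x = MinimalRep.one := by
  rcases (MinimalRep.one : MinimalRep M X).cases x with ⟨y, -, -, hn⟩ | ⟨-, h, -⟩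
  · exact hn
  · rw [MinimalRep.one_output] at h
    cases h

theorem MinimalRep.one_scan_inclWord (η : List (X × Bool)) :
    (MinimalRep.one : MinimalRep M X).scan (inclWord η) = η ∧
      (MinimalRep.one : MinimalRep M X).last (inclWord η) = MinimalRep.one := by
  induction η with
  | nil => exact ⟨rfl, rfl⟩
  | cons a η ih =>
    obtain ⟨x, b⟩ := a
    change (MinimalRep.one : MinimalRep M X).scan (((x : I), b) :: inclWord η) = _ ∧
      (MinimalRep.one : MinimalRep M X).last (((x : I), b) :: inclWord η) = _
    rw [MinimalRep.scan, MinimalRep.last, MinimalRep.one_output, MinimalRep.one_next, ih.1]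
    exact ⟨rfl, ih.2⟩

theorem piMap_incl_mul (a : ArtinGroup (restrict M X)) (b : ArtinGroup M) :
    piMap M X (incl M X a * b) = a * piMap M X b := by
  obtain ⟨η, rfl⟩ := eval_surjective _ a
  obtain ⟨ω, rfl⟩ := eval_surjective _ b
  rw [piMap_eq_artinAction, incl_eval, map_mul, MulOpposite.unop_mul, Equiv.Perm.mul_apply,
    artinAction_eval (inclWord η), (MinimalRep.one_scan_inclWord η).1, (MinimalRep.one_scan_inclWord η).2,
    artinAction_eval, one_mul, piMap_eval, piWord_eq_scan]

theorem piMap_incl (a : ArtinGroup (restrict M X)) : piMap M X (incl M X a) = a := by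
  obtain ⟨η, rfl⟩ := eval_surjective _ a
  rw [incl_eval, piMap_eval, piWord_eq_scan, (MinimalRep.one_scan_inclWord η).1]

/-- The right action of the Coxeter group on `W_X × (W_X \ W_I)`. -/
noncomputable def coxeterAction (M : CoxeterMatrix I) (X : Set I) :
    M.Group →* (Equiv.Perm ((restrict M X).Group × MinimalRep M X))ᵐᵒᵖ :=
  M.toCoxeterSystem.lift
    ⟨fun i => MulOpposite.op (readPerm (M := M) (restrict M X).simple i), fun i j => by
      have hinv (i : I) : MulOpposite.op (readPerm (M := M) (restrict M X).simple i) *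
          MulOpposite.op (readPerm (M := M) (restrict M X).simple i) = 1 := by
        apply MulOpposite.unop_injective
        apply Equiv.ext
        rintro ⟨a, w⟩
        change (a * (w.output i).elim 1 _ * ((w.next i).output i).elim 1 _, (w.next i).next i) =
          (a, w)
        rw [MinimalRep.next_next, MinimalRep.output_next]
        rcases w.output i with _ | x
        · simp
        · simp [mul_assoc, simple_mul_self]
      by_cases hm : M i j = 0
      · rw [hm, pow_zero]
      · exact (altProd_eq_iff (hinv i) (hinv j) _).1
          (altProd_readPerm _ (altProd_simple (restrict M X)) hm)⟩

/-- The canonical morphism from the Coxeter group of a full subgraph. -/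
def coxeterIncl (M : CoxeterMatrix I) (X : Set I) : (restrict M X).Group →* M.Group :=
  (restrict M X).toCoxeterSystem.lift
    ⟨fun x => M.simple x, fun x y => M.toCoxeterSystem.simple_mul_simple_pow x y⟩

theorem coxeterIncl_simple (x : X) : coxeterIncl M X ((restrict M X).simple x) = M.simple x :=
  (restrict M X).toCoxeterSystem.lift_apply_simple _ x

/-- The orbit map of the base point recovers `v`, which embeds the Coxeter group of `Γ_X` in `W_I`.
-/
theorem coxeterAction_coxeterIncl (v : (restrict M X).Group) :
    (coxeterAction M X (coxeterIncl M X v)).unop (1, MinimalRep.one) = (v, MinimalRep.one) := by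
  induction v using (restrict M X).toCoxeterSystem.simple_induction_right with
  | one => simp
  | mul_simple_right v x ih =>
    rw [CoxeterMatrix.toCoxeterSystem_simple, map_mul, map_mul, MulOpposite.unop_mul,
      Equiv.Perm.mul_apply, ih, coxeterIncl_simple]
    have h : coxeterAction M X (M.simple x) =
        MulOpposite.op (readPerm (M := M) (restrict M X).simple x) :=
      M.toCoxeterSystem.lift_apply_simple _ _
    rw [h]
    change (v * ((MinimalRep.one : MinimalRep M X).output x).elim 1 _, MinimalRep.one.next _) = _
    rw [MinimalRep.one_output, MinimalRep.one_next]
    rfl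

theorem coxeterIncl_injective : Function.Injective (coxeterIncl M X) := by
  intro u v h
  have := coxeterAction_coxeterIncl u
  rw [h, coxeterAction_coxeterIncl] at this
  exact (Prod.ext_iff.1 this).1.symm

end Action

/-! ### Compatibility of the retractions for different subsets -/

section Functoriality

variable {M : CoxeterMatrix I}

/-- The filter defining `π*_{Y,X}` is taken in the Coxeter group of `Γ_Y`; this allows it to be
tested in `W_I`. -/
theorem coxeterIncl_mem_iff {X Y : Set I} (hXY : X ⊆ Y) (v : (restrict M Y).Group) :
    coxeterIncl M Y v ∈ coxeterParabolic M X ↔ v ∈ coxeterParabolic (restrict M Y) (sub X Y) := by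
  have h : (coxeterParabolic (restrict M Y) (sub X Y)).map (coxeterIncl M Y) =
      coxeterParabolic M X := by
    rw [coxeterParabolic, coxeterParabolic, MonoidHom.map_closure, Set.image_image]
    congr 1
    ext w
    constructor
    · rintro ⟨y, hy, rfl⟩
      exact ⟨y, hy, (coxeterIncl_simple y).symm⟩
    · rintro ⟨x, hx, rfl⟩
      exact ⟨⟨x, hXY hx⟩, hx, coxeterIncl_simple _⟩
  rw [← h, Subgroup.mem_map_iff_mem coxeterIncl_injective]

theorem signedReflections_inclWord {Y : Set I} (η : List (Y × Bool)) :
    signedReflections M (inclWord η) =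
      (signedReflections (restrict M Y) η).map (Prod.map (coxeterIncl M Y) id) := by
  induction η with
  | nil => rfl
  | cons a η ih =>
    obtain ⟨y, b⟩ := a
    change signedReflections M (((y : I), b) :: inclWord η) = _
    rw [signedReflections_cons, signedReflections_cons, ih, List.map_cons, List.map_map,
      List.map_map]
    refine congrArg₂ _ ?_ (List.map_congr_left fun p _ => ?_)
    · simp [coxeterIncl_simple]
    · simp [conjSigned, coxeterIncl_simple]

theorem inclWord_piWord_restrict {X Y : Set I} (hXY : X ⊆ Y) (η : List (Y × Bool)) :
    inclWord (inclWord (piWord (restrict M Y) (sub X Y) η)) =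
      inclWord (piWord M X (inclWord η)) := by
  apply signedReflections_injective M
  rw [signedReflections_inclWord, signedReflections_piWord, signedReflections_piWord,
    signedReflections_inclWord, List.filter_map]
  congr 1
  apply List.filter_congr
  intro p _
  apply decide_eq_decide.2
  exact (coxeterIncl_mem_iff hXY p.1).symm

/-- Filtering by `W_X` and then by `W_Y` is filtering by `W_X ∩ W_Y = W_{X ∩ Y}`, and the remaining
reflections determine the word. -/
theorem inclWord_piWord_piWord (X Y : Set I) (ω : List (I × Bool)) :
    inclWord (piWord M Y (inclWord (piWord M X ω))) = inclWord (piWord M (X ∩ Y) ω) := by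
  apply signedReflections_injective M
  rw [signedReflections_piWord, signedReflections_piWord, signedReflections_piWord,
    List.filter_filter]
  apply List.filter_congr
  intro p _
  rw [← coxeterParabolic_inter, Bool.eq_iff_iff]
  simp [Subgroup.mem_inf, and_comm]

theorem inclWord_piWord_congr {X Y : Set I} (h : X = Y) (ω : List (I × Bool)) :
    inclWord (piWord M X ω) = inclWord (piWord M Y ω) := by
  subst h; rfl

end Functoriality

end ArtinTits

theorem corollary1 {I : Type*} [Finite I] (M : CoxeterMatrix I) :
    -- each `A_X` embeds in `A_I`, so that it can be identified with its image
    (∀ X : Set I, Function.Injective (ArtinTits.incl M X)) ∧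
    -- the map on words is well defined
    (∀ (X : Set I) (ω : List (I × Bool)),
      ArtinTits.IsRetractWord M X ω (ArtinTits.piWord M X ω) ∧
      ∀ η, ArtinTits.IsRetractWord M X ω η → η = ArtinTits.piWord M X ω) ∧
    -- it induces the map `π_{I,X} : A_I → A_X`
    (∀ (X : Set I) (ω : List (I × Bool)),
      ArtinTits.piMap M X (ArtinTits.eval M ω) =
        ArtinTits.eval (ArtinTits.restrict M X) (ArtinTits.piWord M X ω)) ∧
    -- (i) `π_{I,X}` is a retraction
    (∀ (X : Set I) (a : ArtinTits.ArtinGroup (ArtinTits.restrict M X)),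
      ArtinTits.piMap M X (ArtinTits.incl M X a) = a) ∧
    -- (ii) `π_{I,X}(a b) = a π_{I,X}(b)` for `a ∈ A_X` and `b ∈ A_I`
    (∀ (X : Set I) (a : ArtinTits.ArtinGroup (ArtinTits.restrict M X))
      (b : ArtinTits.ArtinGroup M),
      ArtinTits.piMap M X (ArtinTits.incl M X a * b) = a * ArtinTits.piMap M X b) ∧
    -- (iii) `π_{I,Y} ∘ π_{I,X} = π_{I,X} ∘ π_{I,Y} = π_{I,X ∩ Y}`, as equalities in `A_I`
    (∀ (X Y : Set I) (a : ArtinTits.ArtinGroup M),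
      ArtinTits.incl M Y (ArtinTits.piMap M Y (ArtinTits.incl M X (ArtinTits.piMap M X a))) =
        ArtinTits.incl M X (ArtinTits.piMap M X (ArtinTits.incl M Y (ArtinTits.piMap M Y a))) ∧
      ArtinTits.incl M X (ArtinTits.piMap M X (ArtinTits.incl M Y (ArtinTits.piMap M Y a))) =
        ArtinTits.incl M (X ∩ Y) (ArtinTits.piMap M (X ∩ Y) a)) ∧
    -- (iv) for `X ⊆ Y`: (a) `π_{I,X}` restricts to `π_{Y,X}` on `A_Y`, (b) `π_{Y,X} ∘ π_{I,Y} = π_{I,X}`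
    (∀ X Y : Set I, X ⊆ Y →
      (∀ a : ArtinTits.ArtinGroup (ArtinTits.restrict M Y),
        ArtinTits.incl M X (ArtinTits.piMap M X (ArtinTits.incl M Y a)) =
          ArtinTits.incl M Y (ArtinTits.incl (ArtinTits.restrict M Y) (ArtinTits.sub X Y)
            (ArtinTits.piMap (ArtinTits.restrict M Y) (ArtinTits.sub X Y) a))) ∧
      (∀ a : ArtinTits.ArtinGroup M,
        ArtinTits.incl M Y (ArtinTits.incl (ArtinTits.restrict M Y) (ArtinTits.sub X Y)
            (ArtinTits.piMap (ArtinTits.restrict M Y) (ArtinTits.sub X Y)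
              (ArtinTits.piMap M Y a))) =
          ArtinTits.incl M X (ArtinTits.piMap M X a))) := by
  refine ⟨fun X => Function.LeftInverse.injective fun a => ArtinTits.piMap_incl a,
    fun X ω => ⟨ArtinTits.isRetractWord_piWord ω, fun η hη =>
      ArtinTits.isRetractWord_unique M X ω hη (ArtinTits.isRetractWord_piWord ω)⟩,
    fun X ω => ArtinTits.piMap_eval ω, fun X a => ArtinTits.piMap_incl a,
    fun X a b => ArtinTits.piMap_incl_mul a b, fun X Y a => ?_, fun X Y hXY => ⟨fun a => ?_,
      fun a => ?_⟩⟩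
  · obtain ⟨ω, rfl⟩ := ArtinTits.eval_surjective M a
    simp only [ArtinTits.piMap_eval, ArtinTits.incl_eval, ArtinTits.inclWord_piWord_piWord,
      ArtinTits.inclWord_piWord_congr (Set.inter_comm Y X), and_self]
  · obtain ⟨η, rfl⟩ := ArtinTits.eval_surjective _ a
    simp only [ArtinTits.piMap_eval, ArtinTits.incl_eval, ArtinTits.inclWord_piWord_restrict hXY]
  · obtain ⟨ω, rfl⟩ := ArtinTits.eval_surjective M a
    simp only [ArtinTits.piMap_eval, ArtinTits.incl_eval, ArtinTits.inclWord_piWord_restrict hXY,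
      ArtinTits.inclWord_piWord_piWord,
      ArtinTits.inclWord_piWord_congr (Set.inter_eq_self_of_subset_right hXY)]
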